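/- Let $n\ge 2$, $d\ge 1$, and let $\gamma_1,\dots,\gamma_d$ be pairwise disjoint pieces of smooth analytic hypersurface in $\mathbb C^n$ (locally closed complex submanifolds of codimension one). For $\alpha,\beta\in\mathbb C^{n-1}$ let $$L_{\alpha,\beta}:=\{\zeta\in\mathbb C^n:\ \zeta_k=\alpha_k\zeta_n+\beta_k,\ k=1,\dots,n-1\}.$$ Suppose that for all $(\alpha,\beta)$ close to $(0,0)$ and each $j$, the line $L_{\alpha,\beta}$ meets $\gamma_j$ in exactly one point $p_j(\alpha,\beta)$, and transversally. Assume that there are $D\in\mathbb N=\{0,1,2,\dots\}$ and functions $h_{\underline k}$, $\underline k\in\mathbb N^{n-1}$, $|\underline k|\le D+1$, analytic in a connected neighborhood of $0$ in $\mathbb C^{n-1}$, such that for $(\alpha,\beta)$ close to $(0,0)$ $$\sum_{j=1}^d\zeta_n[p_j(\alpha,\beta)]=\sum_{|\underline k|\le D+1}h_{\underline k}(\alpha)\,\beta_1^{k_1}\cdots\beta_{n-1}^{k_{n-1}},$$ where $\zeta_n[p]$ is the $n$-th coordinate of $p$, and that at least one $h_{\underline k}$ with $|\underline k|=D+1$ is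 not identically zero. Then there are a polynomial $P\in\mathbb C[X_1,\dots,X_n]$ of degree $d+D$ and constants $\epsilon,\kappa,K>0$ such that: (i) if $\Gamma_\epsilon:=\bigcup_{\max(\|\alpha\|,\|\beta\|)<\epsilon}L_{\alpha,\beta}$, then for every $\zeta\in\Gamma_\epsilon$ with $\|\zeta\|\ge K$ one has $|P(\zeta)|\ge\kappa\|\zeta\|^d$; (ii) for all $(\alpha,\beta)$ with $\max(\|\alpha\|,\|\beta\|)<\epsilon$, with $V(P):=\{\zeta\in\mathbb C^n: P(\zeta)=0\}$, $$L_{\alpha,\beta}\cap V(P)=\{p_1(\alpha,\beta),\dots,p_d(\alpha,\beta)\}.$$ -/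

import Mathlib

open Filter Topology

namespace AffineWood

/-- `ℂ^n` with its Hermitian norm. -/
abbrev Cn (n : ℕ) : Type := EuclideanSpace ℂ (Fin n)

/-- `f` is a reduced holomorphic equation of `S` near `x`: it is holomorphic near `x`, its
differential at `x` does not vanish, and `S` is the zero set of `f` near `x`. -/
def IsLocalEquation {n : ℕ} (S : Set (Cn n)) (x : Cn n) (f : Cn n → ℂ) : Prop :=
  AnalyticAt ℂ f x ∧ fderiv ℂ f x ≠ 0 ∧ ∀ᶠ y in 𝓝 x, (y ∈ S ↔ f y = 0)

/-- A piece of smooth analytic hypersurface: a (locally closed) complex submanifold of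
codimension one. -/
def IsSmoothHypersurfacePiece {n : ℕ} (S : Set (Cn n)) : Prop :=
  ∀ x ∈ S, ∃ f : Cn n → ℂ, IsLocalEquation S x f

/-- A line through `x ∈ S` with direction vector `v` is transversal to `S` at `x`: the vector `v`
does not lie in the tangent hyperplane of `S` at `x`, which is the kernel of the differential at
`x` of a local equation of `S` (of any of them: the kernel does not depend on the choice). -/
def IsTransversalAt {n : ℕ} (S : Set (Cn n)) (x v : Cn n) : Prop :=
  x ∈ S ∧ ∃ f : Cn n → ℂ, IsLocalEquation S x f ∧ fderiv ℂ f x v ≠ 0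

/-- The affine line `ζ_k = α_k ζ_{N+1} + β_k`, `k = 1, …, N`, in `ℂ^(N+1)`. -/
def line {N : ℕ} (α β : Cn N) : Set (Cn (N + 1)) :=
  {ζ | ∀ k : Fin N, ζ k.castSucc = α k * ζ (Fin.last N) + β k}

/-- The direction vector `(α_1, …, α_N, 1)` of the lines `line α β`. -/
def direction {N : ℕ} (α : Cn N) : Cn (N + 1) :=
  WithLp.toLp 2 (Fin.snoc (α := fun _ => ℂ) (fun k : Fin N => α k) 1)

/-- The union of the lines `line α β` with `max (‖α‖, ‖β‖) < ε`. -/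
def tube (N : ℕ) (ε : ℝ) : Set (Cn (N + 1)) :=
  ⋃ (α : Cn N) (β : Cn N) (_ : max ‖α‖ ‖β‖ < ε), line α β

/-- The multi-indices `k ∈ ℕ^N` with `|k| = k_1 + ⋯ + k_N ≤ r`. -/
def multiIndices (N r : ℕ) : Finset (Fin N → ℕ) :=
  (Finset.range (r + 1)).biUnion fun s => Finset.piAntidiag Finset.univ s

theorem mem_multiIndices {N r : ℕ} {k : Fin N → ℕ} :
    k ∈ multiIndices N r ↔ ∑ i, k i ≤ r := by
  simp [multiIndices]

/-- The affine algebraic variety `V(P)`. -/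
def zeroSet {n : ℕ} (P : MvPolynomial (Fin n) ℂ) : Set (Cn n) :=
  {ζ | MvPolynomial.eval (fun i => ζ i) P = 0}

end AffineWood

/-!
Let `z j (α, β)` be the last coordinate of the point at which the line of parameters `(α, β)` meets
`γ j`, and `S = ∑ j, z j` their sum. By transversality `z j` is analytic
(`analyticAt_last_of_transversal`). The intersection point lies on many lines, which gives the shock
wave equation `∂_α z = z ∂_β z` (`dirDeriv_last_eq`). Consequently the coefficients `a m` of
`∏ j, (X - z j)` satisfy `∂_α a (m + 1) - ∂_β a m = a (m + 1) ∂_β S` and `∂_α a 0 = a 0 ∂_β S`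
(`dirDeriv_rootCoeff`).

Starting from `a d = 1`, these equations show that all `a m` are polynomial in `β` when `S` is. For
the least `m` with `a m ≠ 0` they say that `∂_β S` is the logarithmic derivative of `a m` with
respect to `α`. Since `∂_α` does not raise the degree in `β`, comparing top degrees in
`∂_α a m = a m ∂_β S` shows that `∂_β S` has degree `0` in `β`: the sum is affine in `β`
(`dirDegreeLT_two_sum`). So a polynomial sum, of whatever degree, is already affine, as in Wood's
theorem, and the existence of a monomial of degree `D + 1` forces `D = 0`. With `∂_β S` independent
of `β`, the same recursion bounds the degree of `a m` in `β` by `d - m`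
(`fibreDegreeLT_rootCoeff`), and `P = ∏ j, (ζ_n - z j (0, ζ'))` is a polynomial of degree `d`
(`exists_mvPolynomial_eq_prod`).

On a line of parameters close to `(0, 0)` the polynomial `P` vanishes at the `d` distinct points
`p j (α, β)`, because each of them also lies on a line of parameters `(0, β')`. Hence its
restriction to the line is `c * ∏ j, (t - z j (α, β))` with `c` close to `1`
(`eventually_linePoly_eq`), from which both the lower bound and the description of the zeros can be
read off.
-/

open Filter Topology

namespace AffineWood

/-! ### Directional derivatives of analytic functions -/

section DirectionalDerivative

variable {E : Type*} [NormedAddCommGroup E] [NormedSpace ℂ E] {U : Set E} {f g : E → ℂ}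

/-- The derivative of `f` in the constant direction `v`, as a function. -/
noncomputable def dirDeriv (v : E) (f : E → ℂ) : E → ℂ := fun x => fderiv ℂ f x v

theorem analyticOnNhd_dirDeriv (hf : AnalyticOnNhd ℂ f U) (v : E) :
    AnalyticOnNhd ℂ (dirDeriv v f) U := fun x hx =>
  ((ContinuousLinearMap.apply ℂ ℂ v).analyticAt _).comp (hf.fderiv x hx)

theorem analyticOnNhd_iterate_dirDeriv (hf : AnalyticOnNhd ℂ f U) (v : E) (n : ℕ) :
    AnalyticOnNhd ℂ ((dirDeriv v)^[n] f) U := by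
  induction n with
  | zero => exact hf
  | succ n ih =>
    rw [Function.iterate_succ_apply']
    exact analyticOnNhd_dirDeriv ih v

theorem dirDeriv_congr (hU : IsOpen U) (h : Set.EqOn f g U) (v : E) :
    Set.EqOn (dirDeriv v f) (dirDeriv v g) U := fun x hx => by
  have : f =ᶠ[𝓝 x] g := Filter.eventually_of_mem (hU.mem_nhds hx) h
  simp only [dirDeriv, this.fderiv_eq]

theorem iterate_dirDeriv_congr (hU : IsOpen U) (h : Set.EqOn f g U) (v : E) (n : ℕ) :
    Set.EqOn ((dirDeriv v)^[n] f) ((dirDeriv v)^[n] g) U := by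
  induction n with
  | zero => exact h
  | succ n ih =>
    simp only [Function.iterate_succ_apply']
    exact dirDeriv_congr hU ih v

theorem dirDeriv_const (v : E) (c : ℂ) : dirDeriv v (fun _ => c) = 0 := by
  ext x; simp [dirDeriv]

theorem dirDeriv_add (hf : AnalyticOnNhd ℂ f U) (hg : AnalyticOnNhd ℂ g U) (v : E) :
    Set.EqOn (dirDeriv v (f + g)) (dirDeriv v f + dirDeriv v g) U := fun x hx => by
  simp [dirDeriv, fderiv_add (hf x hx).differentiableAt (hg x hx).differentiableAt]

theorem dirDeriv_sub (hf : AnalyticOnNhd ℂ f U) (hg : AnalyticOnNhd ℂ g U) (v : E) :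
    Set.EqOn (dirDeriv v (f - g)) (dirDeriv v f - dirDeriv v g) U := fun x hx => by
  simp [dirDeriv, fderiv_sub (hf x hx).differentiableAt (hg x hx).differentiableAt]

theorem dirDeriv_mul (hf : AnalyticOnNhd ℂ f U) (hg : AnalyticOnNhd ℂ g U) (v : E) :
    Set.EqOn (dirDeriv v (f * g)) (dirDeriv v f * g + f * dirDeriv v g) U := fun x hx => by
  simp [dirDeriv, fderiv_mul (hf x hx).differentiableAt (hg x hx).differentiableAt]
  ring

theorem dirDeriv_comm (hf : AnalyticOnNhd ℂ f U) (v w : E) :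
    Set.EqOn (dirDeriv v (dirDeriv w f)) (dirDeriv w (dirDeriv v f)) U := fun x hx => by
  have hd : DifferentiableAt ℂ (fderiv ℂ f) x := (hf x hx).fderiv.differentiableAt
  have key : ∀ a b : E, dirDeriv a (dirDeriv b f) x = fderiv ℂ (fderiv ℂ f) x a b := by
    intro a b
    have : dirDeriv b f = fun y => (fderiv ℂ f y) b := rfl
    rw [this, dirDeriv, fderiv_clm_apply hd (differentiableAt_const b)]
    simp
  rw [key, key]
  exact ((hf x hx).contDiffAt (n := ⊤)).isSymmSndFDerivAt_of_omega v w

theorem iterate_dirDeriv_comm (hU : IsOpen U) (hf : AnalyticOnNhd ℂ f U) (v w : E) (n : ℕ) :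
    Set.EqOn ((dirDeriv v)^[n] (dirDeriv w f)) (dirDeriv w ((dirDeriv v)^[n] f)) U := by
  induction n with
  | zero => exact fun x _ => rfl
  | succ n ih =>
    simp only [Function.iterate_succ_apply']
    exact (dirDeriv_congr hU ih v).trans (dirDeriv_comm (analyticOnNhd_iterate_dirDeriv hf v n) v w)

theorem iterate_dirDeriv_zero (v : E) (n : ℕ) : (dirDeriv v)^[n] (0 : E → ℂ) = 0 := by
  induction n with
  | zero => rfl
  | succ n ih => rw [Function.iterate_succ_apply', ih]; exact dirDeriv_const v 0

theorem iterate_dirDeriv_add (hU : IsOpen U) (hf : AnalyticOnNhd ℂ f U) (hg : AnalyticOnNhd ℂ g U)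
    (v : E) (n : ℕ) :
    Set.EqOn ((dirDeriv v)^[n] (f + g)) ((dirDeriv v)^[n] f + (dirDeriv v)^[n] g) U := by
  induction n with
  | zero => exact fun x _ => rfl
  | succ n ih =>
    simp only [Function.iterate_succ_apply']
    exact (dirDeriv_congr hU ih v).trans (dirDeriv_add (analyticOnNhd_iterate_dirDeriv hf v n)
      (analyticOnNhd_iterate_dirDeriv hg v n) v)

/-- A product of analytic functions vanishes on a connected open set only if a factor does. -/
theorem eqOn_zero_or_eqOn_zero_of_mul (hU : IsOpen U) (hc : IsPreconnected U)
    (hf : AnalyticOnNhd ℂ f U) (hg : AnalyticOnNhd ℂ g U) (h : Set.EqOn (f * g) 0 U) :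
    Set.EqOn f 0 U ∨ Set.EqOn g 0 U := by
  by_contra! hcon
  obtain ⟨hf0, hg0⟩ := hcon
  simp only [Set.EqOn, not_forall] at hf0
  obtain ⟨x, hx, hfx⟩ := hf0
  refine hg0 (hg.eqOn_zero_of_preconnected_of_eventuallyEq_zero hc hx ?_)
  filter_upwards [(hf x hx).continuousAt.eventually_ne hfx, hU.mem_nhds hx] with y hy hyU
  exact (mul_eq_zero.1 (h hyU)).resolve_left hy

/-! ### Functions that are polynomial in one direction -/

/-- The analytic function `f` is polynomial of degree less than `n` in the direction `v`, in the
sense that its `n`-th derivative in that direction vanishes on `U`. -/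
def DirDegreeLT (U : Set E) (v : E) (n : ℕ) (f : E → ℂ) : Prop :=
  Set.EqOn ((dirDeriv v)^[n] f) 0 U

variable {v : E} {m n : ℕ}

theorem DirDegreeLT.congr (hU : IsOpen U) (hf : DirDegreeLT U v n f) (h : Set.EqOn g f U) :
    DirDegreeLT U v n g :=
  (iterate_dirDeriv_congr hU h v n).trans hf

theorem DirDegreeLT.mono (hU : IsOpen U) (hf : DirDegreeLT U v n f) (h : n ≤ m) :
    DirDegreeLT U v m f := by
  obtain ⟨k, rfl⟩ := Nat.exists_eq_add_of_le' h
  have := iterate_dirDeriv_congr hU hf v k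
  rw [iterate_dirDeriv_zero, ← Function.iterate_add_apply] at this
  exact this

theorem dirDegreeLT_succ : DirDegreeLT U v (n + 1) f ↔ DirDegreeLT U v n (dirDeriv v f) := Iff.rfl

theorem DirDegreeLT.add (hU : IsOpen U) (hf : AnalyticOnNhd ℂ f U) (hg : AnalyticOnNhd ℂ g U)
    (h : DirDegreeLT U v n f) (h' : DirDegreeLT U v n g) : DirDegreeLT U v n (f + g) :=
  (iterate_dirDeriv_add hU hf hg v n).trans fun x hx => by simp [h hx, h' hx]

theorem DirDegreeLT.sub (hU : IsOpen U) : ∀ {n : ℕ} {f g : E → ℂ}, AnalyticOnNhd ℂ f U →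
    AnalyticOnNhd ℂ g U → DirDegreeLT U v n f → DirDegreeLT U v n g → DirDegreeLT U v n (f - g)
  | 0, f, g, _, _, h, h' => fun x hx => by
      simp [show f x = 0 from h hx, show g x = 0 from h' hx]
  | n + 1, _, _, hf, hg, h, h' =>
      dirDegreeLT_succ.2 <|
        (DirDegreeLT.sub hU (n := n) (analyticOnNhd_dirDeriv hf _) (analyticOnNhd_dirDeriv hg _)
          h h').congr hU (dirDeriv_sub hf hg _)

theorem DirDegreeLT.dirDeriv (hU : IsOpen U) (hf : AnalyticOnNhd ℂ f U) (h : DirDegreeLT U v n f)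
    (w : E) : DirDegreeLT U v n (dirDeriv w f) :=
  (iterate_dirDeriv_comm hU hf v w n).trans
    ((dirDeriv_congr hU h w).trans fun x _ => by
      exact congrFun (dirDeriv_const w 0) x)

theorem DirDegreeLT.mul (hU : IsOpen U) : ∀ {m n : ℕ} {f g : E → ℂ}, AnalyticOnNhd ℂ f U →
    AnalyticOnNhd ℂ g U → DirDegreeLT U v m f → DirDegreeLT U v n g →
    DirDegreeLT U v (m + n) (f * g) := by
  suffices H : ∀ k m n : ℕ, m + n = k → ∀ f g : E → ℂ, AnalyticOnNhd ℂ f U →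
      AnalyticOnNhd ℂ g U → DirDegreeLT U v m f → DirDegreeLT U v n g →
      DirDegreeLT U v (m + n) (f * g) from
    fun {m n f g} hf hg => H _ m n rfl f g hf hg
  have hz : ∀ n, DirDegreeLT U v n (0 : E → ℂ) := fun n x _ => by rw [iterate_dirDeriv_zero]
  intro k
  induction k with
  | zero =>
    intro m n hmn f g hf hg h h'
    obtain rfl : m = 0 := by omega
    exact (hz _).congr hU fun x hx => by simp [show f x = 0 from h hx]
  | succ k ih =>
    intro m n hmn f g hf hg h h'
    rcases m with _ | m
    · exact (hz _).congr hU fun x hx => by simp [show f x = 0 from h hx]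
    rcases n with _ | n
    · exact (hz _).congr hU fun x hx => by simp [show g x = 0 from h' hx]
    have hf' := analyticOnNhd_dirDeriv hf v
    have hg' := analyticOnNhd_dirDeriv hg v
    have e : m + 1 + (n + 1) = (m + n + 1) + 1 := by ring
    rw [e, dirDegreeLT_succ]
    refine DirDegreeLT.congr hU ?_ (dirDeriv_mul hf hg v)
    refine DirDegreeLT.add hU (hf'.mul hg) (hf.mul hg') ?_ ?_
    · exact ih m (n + 1) (by omega) _ _ hf' hg h h'
    · have := ih (m + 1) n (by omega) _ _ hf hg' h h'
      rwa [show m + 1 + n = m + n + 1 by ring] at this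

/-- The leading coefficient of a product, in one direction, is the product of the leading
coefficients, up to a binomial factor. -/
theorem iterate_dirDeriv_mul_top (hU : IsOpen U) (k : ℕ) : ∀ m n : ℕ, m + n = k →
    ∀ f g : E → ℂ, AnalyticOnNhd ℂ f U → AnalyticOnNhd ℂ g U →
    DirDegreeLT U v (m + 1) f → DirDegreeLT U v (n + 1) g →
    Set.EqOn ((dirDeriv v)^[k] (f * g))
      (fun x => (k.choose m : ℂ) * ((dirDeriv v)^[m] f x * (dirDeriv v)^[n] g x)) U := by
  induction k with
  | zero =>
    intro m n hmn f g hf hg h h'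
    obtain ⟨rfl, rfl⟩ : m = 0 ∧ n = 0 := by omega
    exact fun x _ => by simp
  | succ k ih =>
    intro m n hmn f g hf hg h h'
    have hf' := analyticOnNhd_dirDeriv hf v
    have hg' := analyticOnNhd_dirDeriv hg v
    have e1 := iterate_dirDeriv_congr hU (dirDeriv_mul hf hg v) v k
    have e2 : Set.EqOn ((dirDeriv v)^[k] (dirDeriv v f * g + f * dirDeriv v g))
        ((dirDeriv v)^[k] (dirDeriv v f * g) + (dirDeriv v)^[k] (f * dirDeriv v g)) U :=
      iterate_dirDeriv_add hU (hf'.mul hg) (hf.mul hg') v k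
    have hz : (dirDeriv v)^[k] (0 : E → ℂ) = 0 := iterate_dirDeriv_zero v k
    rw [← Function.iterate_succ_apply] at e1
    have hE := e1.trans e2
    rcases m with _ | m
    · obtain rfl : n = k + 1 := by omega
      intro x hx
      have a1 : Set.EqOn ((dirDeriv v)^[k] (dirDeriv v f * g)) 0 U := by
        rw [← hz]
        exact iterate_dirDeriv_congr hU
          (fun y hy => by simp [show dirDeriv v f y = 0 from h hy]) v k
      have a2 := ih 0 k (by omega) f (dirDeriv v g) hf hg' h h'
      rw [hE hx, Pi.add_apply, a1 hx, a2 hx]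
      simp
    rcases n with _ | n
    · obtain rfl : m = k := by omega
      intro x hx
      have a1 : Set.EqOn ((dirDeriv v)^[m] (f * dirDeriv v g)) 0 U := by
        rw [← hz]
        exact iterate_dirDeriv_congr hU
          (fun y hy => by simp [show dirDeriv v g y = 0 from h' hy]) v m
      have a2 := ih m 0 (by omega) (dirDeriv v f) g hf' hg h h'
      rw [hE hx, Pi.add_apply, a1 hx, a2 hx]
      simp
    · intro x hx
      have a1 := ih m (n + 1) (by omega) (dirDeriv v f) g hf' hg h h'
      have a2 := ih (m + 1) n (by omega) f (dirDeriv v g) hf hg' h h'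
      rw [hE hx, Pi.add_apply, a1 hx, a2 hx, Nat.choose_succ_succ]
      simp only [Function.iterate_succ_apply]
      push_cast
      ring

theorem exists_leading (h0 : ¬ Set.EqOn f 0 U) (h : ∃ n, DirDegreeLT U v n f) :
    ∃ n, DirDegreeLT U v (n + 1) f ∧ ¬ DirDegreeLT U v n f := by
  classical
  have hpos : Nat.find h ≠ 0 := fun h1 => h0 (by have := Nat.find_spec h; rwa [h1] at this)
  obtain ⟨n, hn⟩ := Nat.exists_eq_succ_of_ne_zero hpos
  refine ⟨n, ?_, Nat.find_min h (by omega)⟩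
  have := Nat.find_spec h
  rwa [hn] at this

/-- If `a ≠ 0` is polynomial in the direction `v` and its logarithmic derivative `g` in another
direction is polynomial in the direction `v` too, then `g` is constant in that direction: the
derivative of `a` has at most the degree of `a`, which is less than that of `a * g` otherwise. -/
theorem dirDegreeLT_one_of_logDeriv (hU : IsOpen U) (hc : IsPreconnected U) {a : E → ℂ} {w : E}
    (ha : AnalyticOnNhd ℂ a U) (hg : AnalyticOnNhd ℂ g U) (ha0 : ¬ Set.EqOn a 0 U)
    (hpa : ∃ n, DirDegreeLT U v n a) (hpg : ∃ n, DirDegreeLT U v n g)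
    (h : Set.EqOn (dirDeriv w a) (a * g) U) : DirDegreeLT U v 1 g := by
  by_cases hg0 : Set.EqOn g 0 U
  · exact DirDegreeLT.mono hU (n := 0) hg0 zero_le_one
  obtain ⟨m, hm, hm'⟩ := exists_leading ha0 hpa
  obtain ⟨n, hn, hn'⟩ := exists_leading hg0 hpg
  rcases n with _ | n
  · exact hn
  exfalso
  have h1 := iterate_dirDeriv_mul_top hU _ m (n + 1) rfl a g ha hg hm hn
  have h2 : DirDegreeLT U v (m + (n + 1)) (a * g) :=
    ((hm.mono hU (by omega)).dirDeriv hU ha w).congr hU h.symm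
  have h3 : Set.EqOn ((dirDeriv v)^[m] a * (dirDeriv v)^[n + 1] g) 0 U := fun x hx => by
    have := (h1 hx).symm.trans (h2 hx)
    refine (mul_eq_zero.1 this).resolve_left ?_
    exact_mod_cast (Nat.choose_pos (by omega)).ne'
  rcases eqOn_zero_or_eqOn_zero_of_mul hU hc (analyticOnNhd_iterate_dirDeriv ha v m)
    (analyticOnNhd_iterate_dirDeriv hg v _) h3 with h4 | h4
  exacts [hm' h4, hn' h4]

end DirectionalDerivative

/-! ### The coefficients of a polynomial whose roots obey the shock wave equation -/

section Coefficients

open Polynomial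

variable {E ι : Type*} {z : ι → E → ℂ}

/-- The coefficient of `X ^ m` in `∏ j ∈ s, (X - z j)`, as a function of the parameters on which
the roots `z j` depend. -/
noncomputable def rootCoeff (z : ι → E → ℂ) (s : Finset ι) (m : ℕ) : E → ℂ :=
  fun x => (∏ j ∈ s, (X - C (z j x))).coeff m

theorem rootCoeff_insert_zero [DecidableEq ι] {s : Finset ι} {j : ι} (hj : j ∉ s) :
    rootCoeff z (insert j s) 0 = - (z j * rootCoeff z s 0) := by
  ext x
  simp [rootCoeff, Finset.prod_insert hj, sub_mul, mul_coeff_zero]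

theorem rootCoeff_insert_succ [DecidableEq ι] {s : Finset ι} {j : ι} (hj : j ∉ s) (m : ℕ) :
    rootCoeff z (insert j s) (m + 1) = rootCoeff z s m - z j * rootCoeff z s (m + 1) := by
  ext x
  simp [rootCoeff, Finset.prod_insert hj, sub_mul, coeff_X_mul]

theorem rootCoeff_card (z : ι → E → ℂ) (s : Finset ι) : rootCoeff z s s.card = 1 := by
  ext x
  have h := monic_prod_of_monic s (fun j => X - C (z j x)) fun j _ => monic_X_sub_C _
  have hd : (∏ j ∈ s, (X - C (z j x))).natDegree = s.card :=
    natDegree_finsetProd_X_sub_C_eq_card s fun j => z j x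
  rw [Monic, leadingCoeff, hd] at h
  exact h

theorem sum_rootCoeff_mul_pow (z : ι → E → ℂ) (s : Finset ι) (x : E) (t : ℂ) :
    ∑ m ∈ Finset.range (s.card + 1), rootCoeff z s m x * t ^ m = ∏ j ∈ s, (t - z j x) := by
  have hd : (∏ j ∈ s, (X - C (z j x))).natDegree = s.card :=
    natDegree_finsetProd_X_sub_C_eq_card s fun j => z j x
  have := eval_eq_sum_range (p := ∏ j ∈ s, (X - C (z j x))) t
  rw [hd, eval_prod] at this
  simp only [eval_sub, eval_X, eval_C] at this
  exact this.symm

variable [NormedAddCommGroup E] [NormedSpace ℂ E] {U : Set E} {u w : E}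

theorem analyticOnNhd_rootCoeff (hz : ∀ j, AnalyticOnNhd ℂ (z j) U) (s : Finset ι) :
    ∀ m, AnalyticOnNhd ℂ (rootCoeff z s m) U := by
  classical
  induction s using Finset.induction_on with
  | empty =>
    intro m
    exact analyticOnNhd_const (𝕜 := ℂ) (E := E) (F := ℂ)
      (v := (∏ j ∈ (∅ : Finset ι), (X - C (0 : ℂ))).coeff m)
  | insert j s hj ih =>
    intro m
    cases m with
    | zero => rw [rootCoeff_insert_zero hj]; exact ((hz j).mul (ih 0)).neg
    | succ m => rw [rootCoeff_insert_succ hj]; exact (ih m).sub ((hz j).mul (ih _))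

/-- If the roots satisfy the shock wave equation `∂_u z = z ∂_w z`, the coefficients `a m` of
`∏ j, (X - z j)` satisfy `∂_u a (m + 1) - ∂_w a m = a (m + 1) ∂_w S` with `S = ∑ j, z j`, and
`∂_u a 0 = a 0 ∂_w S`. -/
theorem dirDeriv_rootCoeff (hz : ∀ j, AnalyticOnNhd ℂ (z j) U)
    (hshock : ∀ j, Set.EqOn (dirDeriv u (z j)) (z j * dirDeriv w (z j)) U) (s : Finset ι) :
    Set.EqOn (dirDeriv u (rootCoeff z s 0)) (rootCoeff z s 0 * dirDeriv w (∑ j ∈ s, z j)) U ∧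
    ∀ m, Set.EqOn (dirDeriv u (rootCoeff z s (m + 1)) - dirDeriv w (rootCoeff z s m))
      (rootCoeff z s (m + 1) * dirDeriv w (∑ j ∈ s, z j)) U := by
  classical
  induction s using Finset.induction_on with
  | empty =>
    have h : ∀ m (v : E), dirDeriv v (rootCoeff z ∅ m) = 0 := fun m v =>
      dirDeriv_const v ((∏ j ∈ (∅ : Finset ι), (X - C (0 : ℂ))).coeff m)
    have h' : dirDeriv w (∑ j ∈ (∅ : Finset ι), z j) = 0 := dirDeriv_const w 0
    simp only [h, h']
    simp [Set.EqOn]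
  | insert j s hj ih =>
    have hc := analyticOnNhd_rootCoeff hz s
    have hS : AnalyticOnNhd ℂ (∑ j ∈ s, z j) U := Finset.analyticOnNhd_sum _ fun j _ => hz j
    have hmul : ∀ m (v : E), Set.EqOn (dirDeriv v (z j * rootCoeff z s m))
        (dirDeriv v (z j) * rootCoeff z s m + z j * dirDeriv v (rootCoeff z s m)) U :=
      fun m v => dirDeriv_mul (hz j) (hc m) v
    have hzero : ∀ v : E, Set.EqOn (dirDeriv v (rootCoeff z (insert j s) 0))
        (- (dirDeriv v (z j) * rootCoeff z s 0 + z j * dirDeriv v (rootCoeff z s 0))) U := by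
      intro v x hx
      rw [rootCoeff_insert_zero hj, Pi.neg_apply, ← hmul 0 v hx]
      simp [dirDeriv, fderiv_neg]
    have hsucc : ∀ m (v : E), Set.EqOn (dirDeriv v (rootCoeff z (insert j s) (m + 1)))
        (dirDeriv v (rootCoeff z s m) - (dirDeriv v (z j) * rootCoeff z s (m + 1) +
          z j * dirDeriv v (rootCoeff z s (m + 1)))) U := by
      intro m v x hx
      rw [rootCoeff_insert_succ hj, Pi.sub_apply, ← hmul (m + 1) v hx]
      exact dirDeriv_sub (hc m) ((hz j).mul (hc (m + 1))) v hx
    have hsum : Set.EqOn (dirDeriv w (∑ j ∈ insert j s, z j))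
        (dirDeriv w (z j) + dirDeriv w (∑ j ∈ s, z j)) U := by
      rw [Finset.sum_insert hj]
      exact dirDeriv_add (hz j) hS w
    obtain ⟨ih0, ih1⟩ := ih
    refine ⟨fun x hx => ?_, fun m x hx => ?_⟩
    · have h1 := ih0 hx
      have h2 := hshock j hx
      rw [hzero u hx, Pi.mul_apply, hsum hx, rootCoeff_insert_zero hj]
      simp only [Pi.mul_apply, Pi.add_apply, Pi.neg_apply] at h1 h2 ⊢
      rw [h1, h2]; ring
    · have h1 := ih1 m hx
      have h2 := hshock j hx
      rw [Pi.sub_apply, hsucc m u hx, Pi.mul_apply, hsum hx, rootCoeff_insert_succ hj]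
      cases m with
      | zero =>
        have h0 := ih0 hx
        rw [hzero w hx]
        simp only [Pi.mul_apply, Pi.add_apply, Pi.neg_apply, Pi.sub_apply] at h0 h1 h2 ⊢
        rw [eq_add_of_sub_eq h1, h2, h0]; ring
      | succ m =>
        have h0 := ih1 m hx
        rw [hsucc m w hx]
        simp only [Pi.mul_apply, Pi.add_apply, Pi.sub_apply] at h0 h1 h2 ⊢
        rw [eq_add_of_sub_eq h1, h2, eq_add_of_sub_eq h0]; ring

/-- If roots obeying the shock wave equation have a sum that is polynomial in the direction `w`,
this sum is affine in that direction. This is what rules out sums of higher degree. -/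
theorem dirDegreeLT_two_sum (hU : IsOpen U) (hc : IsPreconnected U) (hne : U.Nonempty)
    (hz : ∀ j, AnalyticOnNhd ℂ (z j) U)
    (hshock : ∀ j, Set.EqOn (dirDeriv u (z j)) (z j * dirDeriv w (z j)) U) (s : Finset ι)
    (hS : ∃ n, DirDegreeLT U w n (∑ j ∈ s, z j)) : DirDegreeLT U w 2 (∑ j ∈ s, z j) := by
  classical
  obtain ⟨e0, e1⟩ := dirDeriv_rootCoeff hz hshock s
  set a := rootCoeff z s with ha
  set S := ∑ j ∈ s, z j with hSdef
  have haa : ∀ m, AnalyticOnNhd ℂ (a m) U := analyticOnNhd_rootCoeff hz s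
  have hSa : AnalyticOnNhd ℂ S U := Finset.analyticOnNhd_sum _ fun j _ => hz j
  have hTa := analyticOnNhd_dirDeriv hSa w
  have hT : ∃ n, DirDegreeLT U w n (dirDeriv w S) := by
    obtain ⟨n, hn⟩ := hS
    exact ⟨n, hn.dirDeriv hU hSa w⟩
  -- Each coefficient is obtained from the next one by an integration in the direction `w`.
  have hpoly : ∀ i m, m + i = s.card → ∃ n, DirDegreeLT U w n (a m) := by
    intro i
    induction i with
    | zero =>
      intro m hm
      obtain rfl : m = s.card := by omega
      refine ⟨1, ?_⟩
      rw [ha, rootCoeff_card]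
      intro x _
      exact congrFun (dirDeriv_const w 1) x
    | succ i ih =>
      intro m hm
      obtain ⟨n, hn⟩ := ih (m + 1) (by omega)
      obtain ⟨n', hn'⟩ := hT
      refine ⟨n + n' + 1, ?_⟩
      rw [dirDegreeLT_succ]
      have h1 : DirDegreeLT U w (n + n') (dirDeriv u (a (m + 1))) :=
        (hn.dirDeriv hU (haa _) u).mono hU (by omega)
      have h2 : DirDegreeLT U w (n + n') (a (m + 1) * dirDeriv w S) :=
        DirDegreeLT.mul hU (haa _) hTa hn hn'
      refine (DirDegreeLT.sub hU (analyticOnNhd_dirDeriv (haa (m + 1)) u)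
        ((haa (m + 1)).mul hTa) h1 h2).congr hU fun x hx => ?_
      have := e1 m hx
      simp only [Pi.mul_apply, Pi.sub_apply] at this ⊢
      linear_combination -this
  have hne0 : ∃ m, ¬ Set.EqOn (a m) 0 U := by
    refine ⟨s.card, fun h => ?_⟩
    obtain ⟨x, hx⟩ := hne
    have := h hx
    rw [ha, rootCoeff_card] at this
    simp at this
  -- The equation for the lowest coefficient that does not vanish says that its logarithmic
  -- derivative in the direction `u` is `∂_w S`.
  have hmin := Nat.find_spec hne0
  have hlt : ∀ k < Nat.find hne0, Set.EqOn (a k) 0 U := fun k hk => not_not.1 (Nat.find_min hne0 hk)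
  have hle : Nat.find hne0 ≤ s.card := Nat.find_min' hne0 fun h => by
    obtain ⟨x, hx⟩ := hne
    have := h hx
    rw [ha, rootCoeff_card] at this
    simp at this
  generalize Nat.find hne0 = m at hmin hlt hle
  have heq : Set.EqOn (dirDeriv u (a m)) (a m * dirDeriv w S) U := by
    rcases m with _ | m
    · exact e0
    · intro x hx
      have h1 := e1 m hx
      have h2 : dirDeriv w (a m) x = 0 :=
        (dirDeriv_congr hU (hlt m (by omega)) w hx).trans (congrFun (dirDeriv_const w 0) x)
      rw [Pi.sub_apply, h2, sub_zero] at h1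
      exact h1
  exact dirDegreeLT_one_of_logDeriv hU hc (haa m) hTa hmin (hpoly (s.card - m) m (by omega)) hT heq

end Coefficients

/-! ### Functions that are polynomial in the second variable -/

section FibreDegree

variable {F G : Type*} [NormedAddCommGroup F] [NormedSpace ℂ F] [NormedAddCommGroup G]
  [NormedSpace ℂ G] {U : Set (F × G)} {f g : F × G → ℂ}

/-- The analytic function `f` is polynomial of degree less than `n` in the second variable, in the
sense that all its derivatives of order `n` in that variable vanish on `U`. -/
def FibreDegreeLT (U : Set (F × G)) : ℕ → (F × G → ℂ) → Prop
  | 0, f => Set.EqOn f 0 U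
  | n + 1, f => ∀ v : G, FibreDegreeLT U n (dirDeriv (0, v) f)

theorem FibreDegreeLT.congr (hU : IsOpen U) : ∀ {n : ℕ} {f g : F × G → ℂ},
    FibreDegreeLT U n f → Set.EqOn g f U → FibreDegreeLT U n g
  | 0, _, _, hf, h => h.trans hf
  | n + 1, _, _, hf, h => fun v => FibreDegreeLT.congr hU (n := n) (hf v) (dirDeriv_congr hU h _)

theorem FibreDegreeLT.sub (hU : IsOpen U) : ∀ {n : ℕ} {f g : F × G → ℂ}, AnalyticOnNhd ℂ f U →
    AnalyticOnNhd ℂ g U → FibreDegreeLT U n f → FibreDegreeLT U n g → FibreDegreeLT U n (f - g)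
  | 0, _, _, _, _, h, h' => fun x hx => by simp [h hx, h' hx]
  | n + 1, _, _, hf, hg, h, h' => fun v =>
      (FibreDegreeLT.sub hU (n := n) (analyticOnNhd_dirDeriv hf _) (analyticOnNhd_dirDeriv hg _)
        (h v) (h' v)).congr hU (dirDeriv_sub hf hg _)

theorem FibreDegreeLT.dirDeriv (hU : IsOpen U) (w : F × G) : ∀ {n : ℕ} {f : F × G → ℂ},
    AnalyticOnNhd ℂ f U → FibreDegreeLT U n f → FibreDegreeLT U n (dirDeriv w f)
  | 0, _, _, h => (dirDeriv_congr hU h w).trans fun x _ => congrFun (dirDeriv_const w 0) x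
  | n + 1, _, hf, h => fun v =>
      (FibreDegreeLT.dirDeriv hU w (n := n) (analyticOnNhd_dirDeriv hf _) (h v)).congr hU
        (dirDeriv_comm hf _ _)

/-- Multiplication by a function of the first variable alone does not raise the degree. -/
theorem FibreDegreeLT.mul_one (hU : IsOpen U) : ∀ {n : ℕ} {f g : F × G → ℂ}, AnalyticOnNhd ℂ f U →
    AnalyticOnNhd ℂ g U → FibreDegreeLT U n f → FibreDegreeLT U 1 g → FibreDegreeLT U n (f * g)
  | 0, _, _, _, _, h, _ => fun x hx => by simp [h hx]
  | n + 1, _, _, hf, hg, h, h' => fun v =>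
      (FibreDegreeLT.mul_one hU (n := n) (analyticOnNhd_dirDeriv hf _) hg (h v) h').congr hU
        fun x hx => by
          have h2 := dirDeriv_mul hf hg (0, v) hx
          have h3 := h' v hx
          rw [h2, Pi.add_apply, Pi.mul_apply, Pi.mul_apply, h3]
          simp

theorem fibreDegreeLT_two_of_forall_dirDegreeLT (hf : AnalyticOnNhd ℂ f U)
    (h : ∀ v : G, DirDegreeLT U (0, v) 2 f) : FibreDegreeLT U 2 f := by
  -- The second derivative is a symmetric bilinear form whose quadratic form vanishes.
  intro v w x hx
  have hadd : ∀ (k : F × G → ℂ) (y : F × G) (a b : G),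
      dirDeriv (0, a + b) k y = dirDeriv (0, a) k y + dirDeriv (0, b) k y := by
    intro k y a b
    have : ((0 : F), a + b) = (0, a) + (0, b) := by simp
    simp only [dirDeriv, this, map_add]
  have hadd' : ∀ c : G, AffineWood.dirDeriv (0, c) (AffineWood.dirDeriv (0, v + w) f) x =
      AffineWood.dirDeriv (0, c) (AffineWood.dirDeriv (0, v) f) x +
      AffineWood.dirDeriv (0, c) (AffineWood.dirDeriv (0, w) f) x := by
    intro c
    rw [← Pi.add_apply, ← dirDeriv_add (analyticOnNhd_dirDeriv hf _)
      (analyticOnNhd_dirDeriv hf _) _ hx]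
    congr 1
    ext y
    exact hadd f y v w
  have h1 := h (v + w) hx
  have h2 := h v hx
  have h3 := h w hx
  have h4 := dirDeriv_comm hf (0, v) (0, w) hx
  simp only [Function.iterate_succ_apply, Function.iterate_zero_apply, Pi.zero_apply] at h1 h2 h3 ⊢
  rw [hadd, hadd', hadd', h2, h3] at h1
  rw [h4] at h1
  linear_combination h1 / 2

end FibreDegree

section Polynomial

theorem eval_smul_of_isHomogeneous {σ : Type*} {φ : MvPolynomial σ ℂ} {m : ℕ}
    (h : φ.IsHomogeneous m) (s : ℂ) (x : σ → ℂ) :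
    MvPolynomial.eval (fun i => s * x i) φ = s ^ m * MvPolynomial.eval x φ := by
  rw [MvPolynomial.eval_eq, MvPolynomial.eval_eq, Finset.mul_sum]
  refine Finset.sum_congr rfl fun d hd => ?_
  have hdeg : ∑ i ∈ d.support, d i = m := by
    have := h (MvPolynomial.mem_support_iff.1 hd)
    simpa [Finsupp.weight_apply, Finsupp.sum] using this
  simp only [mul_pow, Finset.prod_mul_distrib, Finset.prod_pow_eq_pow_sum, hdeg]
  ring

variable {F : Type*} [NormedAddCommGroup F] [NormedSpace ℂ F] {N : ℕ} {A : Set F} {B : Set (Cn N)}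

/-- Integration along the segment from `(α, 0)` to `(α, β)`. -/
theorem sub_eq_of_dirDeriv_eq {G : Type*} [NormedAddCommGroup G] [NormedSpace ℂ G] {B : Set G}
    (hB : IsOpen B) (hBc : Convex ℝ B) (hB0 : (0 : G) ∈ B)
    {f : F × G → ℂ} (hf : AnalyticOnNhd ℂ f (A ×ˢ B)) {α : F} (hα : α ∈ A) {β : G}
    (hβ : β ∈ B) (q : Polynomial ℂ)
    (hq : ∀ s : ℂ, s • β ∈ B → dirDeriv (0, β) f (α, s • β) = q.derivative.eval s) :
    f (α, β) - f (α, 0) = q.eval 1 - q.eval 0 := by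
  let L : Set ℂ := {s | s • β ∈ B}
  have hLo : IsOpen L := hB.preimage (by fun_prop)
  have hLc : IsPreconnected L := by
    have : Convex ℝ L := by
      intro s hs t ht a b ha hb hab
      have := hBc hs ht ha hb hab
      simp only [L, Set.mem_ofPred_eq, add_smul, smul_assoc]
      exact this
    exact this.isPreconnected
  have hder : ∀ s ∈ L, HasDerivAt (fun s : ℂ => f (α, s • β) - q.eval s) 0 s := by
    intro s hs
    have h1 : HasDerivAt (fun s : ℂ => (α, s • β)) ((0 : F), β) s := by
      refine HasDerivAt.prodMk (hasDerivAt_const s α) ?_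
      simpa using (hasDerivAt_id s).smul_const β
    have h2 : HasFDerivAt f (fderiv ℂ f (α, s • β)) (α, s • β) :=
      (hf (α, s • β) ⟨hα, hs⟩).differentiableAt.hasFDerivAt
    have h3 := (h2.comp_hasDerivAt s h1).sub (q.hasDerivAt s)
    have h4 := hq s hs
    rw [dirDeriv] at h4
    rw [h4, sub_self] at h3
    exact h3
  obtain ⟨c, hc⟩ := hLo.exists_is_const_of_deriv_eq_zero hLc
    (fun s hs => (hder s hs).differentiableAt.differentiableWithinAt)
    (fun s hs => (hder s hs).deriv)
  have h1 := hc (x := 1) (by simpa [L] using hβ)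
  have h0 := hc (x := 0) (by simpa [L] using hB0)
  simp only [one_smul, zero_smul] at h1 h0
  linear_combination h1 - h0

/-- A function all of whose derivatives of order `r + 1` in the second variable vanish is a
polynomial of degree at most `r` in that variable. -/
theorem FibreDegreeLT.exists_mvPolynomial (hB : IsOpen B) (hBc : Convex ℝ B)
    (hB0 : (0 : Cn N) ∈ B) {α : F} (hα : α ∈ A) (r : ℕ) :
    ∀ f : F × Cn N → ℂ, AnalyticOnNhd ℂ f (A ×ˢ B) → FibreDegreeLT (A ×ˢ B) (r + 1) f →
    ∃ Q : MvPolynomial (Fin N) ℂ, Q.totalDegree ≤ r ∧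
      ∀ β ∈ B, f (α, β) = MvPolynomial.eval (fun i => β i) Q := by
  have hlin : ∀ (f : F × Cn N → ℂ) (x : F × Cn N) (β : Cn N), AffineWood.dirDeriv (0, β) f x =
      ∑ k, β k * AffineWood.dirDeriv (0, EuclideanSpace.single k 1) f x := by
    intro f x β
    have hβ : ((0 : F), β) = ∑ k, β k • ((0 : F), EuclideanSpace.single k (1 : ℂ)) := by
      ext i
      · simp [Prod.fst_sum]
      · simp [Prod.snd_sum, Finset.sum_apply, Pi.single_apply]
    simp only [AffineWood.dirDeriv]
    conv_lhs => rw [hβ, map_sum]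
    simp only [map_smul, smul_eq_mul]
  induction r with
  | zero =>
    intro f hf h
    refine ⟨MvPolynomial.C (f (α, 0)), by simp, fun β hβ => ?_⟩
    have := sub_eq_of_dirDeriv_eq hB hBc hB0 hf hα hβ 0 fun s hs => by
      simpa using h β ⟨hα, hs⟩
    simp only [Polynomial.eval_zero, sub_zero] at this
    simpa using sub_eq_zero.1 this
  | succ r ih =>
    intro f hf h
    choose Q hQd hQ using fun k : Fin N => ih _ (analyticOnNhd_dirDeriv hf _)
      (h (EuclideanSpace.single k 1))
    have hQsum : ∀ k, Q k =
        ∑ i ∈ Finset.range (r + 1), MvPolynomial.homogeneousComponent i (Q k) := by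
      intro k
      conv_lhs => rw [← MvPolynomial.sum_homogeneousComponent (Q k)]
      refine Finset.sum_subset (Finset.range_subset_range.2 (by have := hQd k; omega))
        fun i _ hi => ?_
      exact MvPolynomial.homogeneousComponent_eq_zero _ _ (by simpa using hi)
    -- A homogeneous component of degree `i` integrates along the segment to a factor `1 / (i + 1)`.
    refine ⟨MvPolynomial.C (f (α, 0)) +
      ∑ i ∈ Finset.range (r + 1), MvPolynomial.C (1 / ((i : ℂ) + 1)) *
        ∑ k, MvPolynomial.X k * MvPolynomial.homogeneousComponent i (Q k), ?_, fun β hβ => ?_⟩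
    · refine (MvPolynomial.totalDegree_add _ _).trans (max_le (by simp) ?_)
      refine MvPolynomial.totalDegree_finsetSum_le fun i hi => ?_
      refine (MvPolynomial.totalDegree_mul _ _).trans ?_
      rw [MvPolynomial.totalDegree_C, zero_add]
      refine MvPolynomial.totalDegree_finsetSum_le fun k _ => ?_
      refine (MvPolynomial.totalDegree_mul _ _).trans ?_
      rw [MvPolynomial.totalDegree_X]
      have := (MvPolynomial.homogeneousComponent_isHomogeneous i (Q k)).totalDegree_le
      have := Finset.mem_range.1 hi
      omega
    · let c : ℕ → ℂ := fun i => ∑ k, β k *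
        MvPolynomial.eval (fun l => β l) (MvPolynomial.homogeneousComponent i (Q k))
      let q : Polynomial ℂ := ∑ i ∈ Finset.range (r + 1),
        Polynomial.C (1 / ((i : ℂ) + 1) * c i) * Polynomial.X ^ (i + 1)
      have key := sub_eq_of_dirDeriv_eq hB hBc hB0 hf hα hβ q fun s hs => by
        have h1 : q.derivative.eval s = ∑ i ∈ Finset.range (r + 1), c i * s ^ i := by
          simp only [q, Polynomial.derivative_sum, Polynomial.eval_finsetSum]
          refine Finset.sum_congr rfl fun i _ => ?_
          have : (i : ℂ) + 1 ≠ 0 := by exact_mod_cast Nat.succ_ne_zero i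
          rw [Polynomial.derivative_C_mul, Polynomial.derivative_X_pow]
          simp
          field_simp
        have h2 : ∀ k, MvPolynomial.eval (fun l => (s • β) l) (Q k) =
            ∑ i ∈ Finset.range (r + 1), s ^ i *
              MvPolynomial.eval (fun l => β l) (MvPolynomial.homogeneousComponent i (Q k)) := by
          intro k
          conv_lhs => rw [hQsum k, map_sum]
          refine Finset.sum_congr rfl fun i _ => ?_
          exact eval_smul_of_isHomogeneous
            (MvPolynomial.homogeneousComponent_isHomogeneous i (Q k)) s _
        rw [h1, hlin]
        simp only [hQ _ _ hs, h2, c, Finset.mul_sum, Finset.sum_mul]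
        rw [Finset.sum_comm]
        refine Finset.sum_congr rfl fun i _ => Finset.sum_congr rfl fun k _ => by ring
      have hq1 : q.eval 1 - q.eval 0 = ∑ i ∈ Finset.range (r + 1), 1 / ((i : ℂ) + 1) * c i := by
        simp [q, Polynomial.eval_finsetSum]
      rw [hq1] at key
      simp only [map_add, map_sum, map_mul, MvPolynomial.eval_C, MvPolynomial.eval_X]
      linear_combination key

end Polynomial

/-! ### Intersection points with lines -/

section Lines

variable {N : ℕ}

/-- The point of the line `line x.1 x.2` whose last coordinate is `t`. -/
noncomputable def linePoint (x : Cn N × Cn N) (t : ℂ) : Cn (N + 1) :=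
  WithLp.toLp 2 (Fin.snoc (α := fun _ => ℂ) (fun k : Fin N => x.1 k * t + x.2 k) t)

@[simp] theorem linePoint_last (x : Cn N × Cn N) (t : ℂ) : linePoint x t (Fin.last N) = t := by
  simp [linePoint]

@[simp] theorem linePoint_castSucc (x : Cn N × Cn N) (t : ℂ) (k : Fin N) :
    linePoint x t k.castSucc = x.1 k * t + x.2 k := by
  simp [linePoint]

theorem mem_line_iff {x : Cn N × Cn N} {ζ : Cn (N + 1)} :
    ζ ∈ line x.1 x.2 ↔ ζ = linePoint x (ζ (Fin.last N)) := by
  constructor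
  · intro h
    ext i
    refine Fin.lastCases ?_ (fun k => ?_) i
    · simp
    · rw [linePoint_castSucc]; exact h k
  · intro h k
    conv_lhs => rw [h]
    simp

theorem linePoint_mem_line (x : Cn N × Cn N) (t : ℂ) : linePoint x t ∈ line x.1 x.2 := by
  rw [mem_line_iff, linePoint_last]

theorem contDiff_linePoint {n : WithTop ℕ∞} :
    ContDiff ℂ n (fun y : (Cn N × Cn N) × ℂ => linePoint y.1 y.2) := by
  rw [contDiff_euclidean]
  intro i
  refine Fin.lastCases ?_ (fun k => ?_) i
  · simpa using contDiff_snd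
  · simp only [linePoint_castSucc]
    have h1 : ContDiff ℂ n (fun y : (Cn N × Cn N) × ℂ => y.1.1 k) :=
      (EuclideanSpace.proj (𝕜 := ℂ) k).contDiff.comp (contDiff_fst.comp contDiff_fst)
    have h2 : ContDiff ℂ n (fun y : (Cn N × Cn N) × ℂ => y.1.2 k) :=
      (EuclideanSpace.proj (𝕜 := ℂ) k).contDiff.comp (contDiff_snd.comp contDiff_fst)
    exact (h1.mul contDiff_snd).add h2

theorem hasDerivAt_linePoint (x : Cn N × Cn N) (t : ℂ) :
    HasDerivAt (linePoint x) (direction x.1) t := by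
  have h : linePoint x = fun s => linePoint x 0 + s • direction x.1 := by
    ext s i
    refine Fin.lastCases ?_ (fun k => ?_) i
    · simp [direction]
    · simp [direction]; ring
  rw [h]
  simpa using ((hasDerivAt_id t).smul_const (direction x.1)).const_add (linePoint x 0)

variable {S : Set (Cn (N + 1))} {q : Cn N × Cn N → Cn (N + 1)} {x y : Cn N × Cn N}

theorem eq_linePoint_of_inter_eq (hq : line x.1 x.2 ∩ S = {q x}) :
    q x = linePoint x (q x (Fin.last N)) :=
  mem_line_iff.1 (hq.symm ▸ Set.mem_singleton (q x) : q x ∈ line x.1 x.2 ∩ S).1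

/-- The point at which a line meets `S` is also the point at which every other line through it
meets `S`. -/
theorem last_eq_of_inter_eq (hx : line x.1 x.2 ∩ S = {q x}) (hy : line y.1 y.2 ∩ S = {q y})
    (h : ∀ k, y.1 k * q x (Fin.last N) + y.2 k = x.1 k * q x (Fin.last N) + x.2 k) :
    q y (Fin.last N) = q x (Fin.last N) := by
  have h1 : q x ∈ line x.1 x.2 ∩ S := hx.symm ▸ Set.mem_singleton (q x)
  have h2 : q x ∈ line y.1 y.2 ∩ S := ⟨fun k => by rw [h k]; exact h1.1 k, h1.2⟩
  rw [hy] at h2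
  rw [Set.mem_singleton_iff.1 h2]

/-- The derivative in `t` of `f` restricted to the lines is its derivative in their direction. -/
theorem fderiv_comp_linePoint {f : Cn (N + 1) → ℂ} {t : ℂ}
    (hf : DifferentiableAt ℂ f (linePoint y t)) :
    fderiv ℂ (fun z : (Cn N × Cn N) × ℂ => f (linePoint z.1 z.2)) (y, t) (0, 1) =
      fderiv ℂ f (linePoint y t) (direction y.1) := by
  have h1 : HasDerivAt (fun t : ℂ => (y, t)) ((0 : Cn N × Cn N), (1 : ℂ)) t :=
    (hasDerivAt_const t y).prodMk (hasDerivAt_id t)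
  have hd : DifferentiableAt ℂ (fun z : (Cn N × Cn N) × ℂ => f (linePoint z.1 z.2)) (y, t) :=
    DifferentiableAt.comp (g := f) (y, t) hf
      ((contDiff_linePoint (n := 1)).differentiable (by simp) _)
  have h2 := hd.hasFDerivAt.comp_hasDerivAt t h1
  have h3 := hf.hasFDerivAt.comp_hasDerivAt t (hasDerivAt_linePoint y t)
  exact h2.unique h3

/-- The point of transversal intersection depends analytically on the line. -/
theorem analyticAt_last_of_transversal (hq : ∀ᶠ x in 𝓝 y, line x.1 x.2 ∩ S = {q x})
    (htr : IsTransversalAt S (q y) (direction y.1)) :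
    AnalyticAt ℂ (fun x => q x (Fin.last N)) y := by
  obtain ⟨hyS, f, ⟨hf, -, hfS⟩, hft⟩ := htr
  set t₀ := q y (Fin.last N) with ht₀
  have hy : q y = linePoint y t₀ := eq_linePoint_of_inter_eq hq.self_of_nhds
  let Φ : (Cn N × Cn N) × ℂ → ℂ := fun z => f (linePoint z.1 z.2)
  have hΦ : ContDiffAt ℂ ⊤ Φ (y, t₀) := by
    refine ContDiffAt.comp (g := f) (y, t₀) ?_ contDiff_linePoint.contDiffAt
    rw [hy] at hf
    exact hf.contDiffAt
  have hΦ1 : fderiv ℂ Φ (y, t₀) (0, 1) = fderiv ℂ f (q y) (direction y.1) := by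
    have h := hf.differentiableAt
    rw [hy] at h
    exact (fderiv_comp_linePoint h).trans (by rw [← hy])
  have hinv : (fderiv ℂ Φ (y, t₀) ∘L .inr ℂ (Cn N × Cn N) ℂ).IsInvertible := by
    refine ⟨ContinuousLinearEquiv.unitsEquivAut ℂ (Units.mk0 _ (hΦ1.symm ▸ hft)), ?_⟩
    ext
    simp
  have hψ := hΦ.contDiffAt_implicitFunction (by simp) hinv
  have hψ0 := hΦ.implicitFunction_apply_self (by simp) hinv
  have hψe := hΦ.eventually_apply_implicitFunction (by simp) hinv
  generalize hΦ.implicitFunction (by simp) hinv = ψ at hψ hψ0 hψe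
  simp only at hψ hψ0 hψe
  refine (hψ.analyticAt).congr ?_
  have hcont : Tendsto (fun x => linePoint x (ψ x)) (𝓝 y) (𝓝 (q y)) := by
    have h1 : Tendsto (fun x => (x, ψ x)) (𝓝 y) (𝓝 (y, t₀)) := by
      have := hψ.continuousAt
      rw [ContinuousAt, hψ0] at this
      exact tendsto_id.prodMk_nhds this
    have h2 := (contDiff_linePoint (N := N) (n := 0)).continuous.tendsto (y, t₀)
    rw [hy]
    have h3 := h2.comp h1
    exact h3
  have hf0 : f (q y) = 0 := hfS.self_of_nhds.1 hyS
  filter_upwards [hq, hψe, hcont.eventually hfS] with x hx hx1 hx2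
  have hxS : linePoint x (ψ x) ∈ S := by
    refine hx2.2 ?_
    have : Φ (y, t₀) = 0 := by simp only [Φ]; rw [← hy, hf0]
    rw [this] at hx1
    exact hx1
  have hm : linePoint x (ψ x) ∈ line x.1 x.2 ∩ S := ⟨linePoint_mem_line x _, hxS⟩
  rw [hx, Set.mem_singleton_iff] at hm
  rw [← hm, linePoint_last]

/-- The shock wave equation: the last coordinate of the intersection point is constant along the
lines of directions `(v, -z v)` in the space of parameters, which consist of lines through that
point. -/
theorem dirDeriv_last_eq (hq : ∀ᶠ x in 𝓝 y, line x.1 x.2 ∩ S = {q x})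
    (hz : AnalyticAt ℂ (fun x => q x (Fin.last N)) y) (v : Cn N) :
    dirDeriv (v, 0) (fun x => q x (Fin.last N)) y =
      q y (Fin.last N) * dirDeriv (0, v) (fun x => q x (Fin.last N)) y := by
  set t₀ := q y (Fin.last N) with ht₀
  let L : ℂ → Cn N × Cn N := fun s => y + s • (v, -(t₀ • v))
  have hL : HasDerivAt L (v, -(t₀ • v)) 0 := by
    have := ((hasDerivAt_id (0 : ℂ)).smul_const (v, -(t₀ • v))).const_add y
    rwa [one_smul] at this
  have hL0 : L 0 = y := by simp [L]
  have hz' : HasFDerivAt (fun x => q x (Fin.last N)) (fderiv ℂ (fun x => q x (Fin.last N)) y)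
      (L 0) := by rw [hL0]; exact hz.differentiableAt.hasFDerivAt
  have h1 := hz'.comp_hasDerivAt 0 hL
  have h2 : (fun _ => t₀) =ᶠ[𝓝 (0 : ℂ)] (fun x => q x (Fin.last N)) ∘ L := by
    have hc : Tendsto L (𝓝 0) (𝓝 y) := by
      have := hL.continuousAt
      rwa [ContinuousAt, hL0] at this
    filter_upwards [hc.eventually hq] with s hs
    refine (last_eq_of_inter_eq hq.self_of_nhds hs fun k => ?_).symm
    simp only [L, Prod.fst_add, Prod.snd_add, Prod.smul_fst, Prod.smul_snd, PiLp.add_apply,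
      PiLp.smul_apply, PiLp.neg_apply, smul_eq_mul, ← ht₀]
    ring
  have h3 := h1.unique ((hasDerivAt_const (0 : ℂ) t₀).congr_of_eventuallyEq h2.symm)
  have h4 : (v, -(t₀ • v)) = (v, (0 : Cn N)) - t₀ • ((0 : Cn N), v) := by
    ext <;> simp
  rw [h4, map_sub, map_smul, smul_eq_mul] at h3
  exact sub_eq_zero.1 h3

end Lines

/-! ### Polynomials in `β` -/

section Polynomials

variable {N : ℕ}

theorem mvPolynomial_eq_of_eventually {P Q : MvPolynomial (Fin N) ℂ}
    (h : ∀ᶠ β in 𝓝 (0 : Cn N),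
      MvPolynomial.eval (fun i => β i) P = MvPolynomial.eval (fun i => β i) Q) : P = Q := by
  have hc : Tendsto (fun x : Fin N → ℂ => (WithLp.toLp 2 x : Cn N)) (𝓝 0) (𝓝 0) :=
    (PiLp.continuous_toLp 2 _).tendsto' _ _ (by simp)
  obtain ⟨δ, hδ, hb⟩ := Metric.eventually_nhds_iff_ball.1 (hc.eventually h)
  have hinf : (Metric.ball (0 : ℂ) δ).Infinite :=
    infinite_of_mem_nhds 0 (Metric.ball_mem_nhds 0 hδ)
  refine MvPolynomial.funext_set (fun _ => Metric.ball (0 : ℂ) δ) (fun _ => hinf) fun x hx => ?_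
  refine hb x ?_
  rw [ball_pi _ hδ]
  exact hx

/-- Polynomials in the second variable with coefficients depending on the first one have
a bounded degree in every direction of the second variable. -/
theorem exists_dirDegreeLT_sum {A B : Set (Cn N)} (hU : IsOpen (A ×ˢ B))
    (s : Finset (Fin N → ℕ)) {h : (Fin N → ℕ) → Cn N → ℂ}
    (hh : ∀ k ∈ s, AnalyticOnNhd ℂ (h k) A) (v : Cn N) :
    ∃ n, DirDegreeLT (A ×ˢ B) (0, v) n
      (fun x : Cn N × Cn N => ∑ k ∈ s, h k x.1 * ∏ i, x.2 i ^ k i) := by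
  let p : (Cn N × Cn N → ℂ) → Prop := fun f =>
    AnalyticOnNhd ℂ f (A ×ˢ B) ∧ ∃ n, DirDegreeLT (A ×ˢ B) (0, v) n f
  have hadd : ∀ f g, p f → p g → p (f + g) := fun f g hf hg => by
    obtain ⟨hf, m, hm⟩ := hf
    obtain ⟨hg, n, hn⟩ := hg
    exact ⟨hf.add hg, max m n, (hm.mono hU (le_max_left _ _)).add hU hf hg
      (hn.mono hU (le_max_right _ _))⟩
  have hmul : ∀ f g, p f → p g → p (f * g) := fun f g hf hg => by
    obtain ⟨hf, m, hm⟩ := hf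
    obtain ⟨hg, n, hn⟩ := hg
    exact ⟨hf.mul hg, m + n, DirDegreeLT.mul hU hf hg hm hn⟩
  have hconst : ∀ c : ℂ, p (fun _ => c) := fun c =>
    ⟨analyticOnNhd_const, 1, fun x _ => congrFun (dirDeriv_const _ c) x⟩
  have hcoord : ∀ i, p (fun x => x.2 i) := fun i => by
    let l : Cn N × Cn N →L[ℂ] ℂ := EuclideanSpace.proj i ∘L ContinuousLinearMap.snd ℂ _ _
    refine ⟨fun x _ => l.analyticAt x, 2, fun x _ => ?_⟩
    have : dirDeriv (0, v) (fun x : Cn N × Cn N => x.2 i) = fun _ => l (0, v) := by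
      ext y
      exact congrArg (fun T : Cn N × Cn N →L[ℂ] ℂ => T (0, v)) (l.hasFDerivAt (x := y)).fderiv
    rw [Function.iterate_succ_apply, this]
    exact congrFun (dirDeriv_const _ _) x
  have hfst : ∀ k ∈ s, p (fun x => h k x.1) := fun k hk => by
    have ha : ∀ x ∈ A ×ˢ B, AnalyticAt ℂ (h k) x.1 := fun x hx => hh k hk _ hx.1
    refine ⟨fun x hx => (ha x hx).fun_comp (analyticAt_fst), 1, fun x hx => ?_⟩
    have := ((ha x hx).differentiableAt.hasFDerivAt.comp x (hasFDerivAt_fst)).fderiv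
    have h2 := congrArg (fun T : Cn N × Cn N →L[ℂ] ℂ => T (0, v)) this
    simpa [dirDeriv, Function.comp_def] using h2
  have hpow : ∀ i n, p ((fun x : Cn N × Cn N => x.2 i) ^ n) := fun i n => by
    induction n with
    | zero => rw [pow_zero]; exact hconst 1
    | succ n ih => rw [pow_succ]; exact hmul _ _ ih (hcoord i)
  have hprod : ∀ k : Fin N → ℕ, p (∏ i, (fun x : Cn N × Cn N => x.2 i) ^ k i) := fun k =>
    Finset.prod_induction _ p hmul (hconst 1) fun i _ => hpow i (k i)
  have hsum : p (∑ k ∈ s, (fun x : Cn N × Cn N => h k x.1) *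
      ∏ i, (fun x : Cn N × Cn N => x.2 i) ^ k i) :=
    Finset.sum_induction _ p hadd (hconst 0) fun k hk => hmul _ _ (hfst k hk) (hprod k)
  have he : (fun x : Cn N × Cn N => ∑ k ∈ s, h k x.1 * ∏ i, x.2 i ^ k i) =
      ∑ k ∈ s, (fun x : Cn N × Cn N => h k x.1) *
        ∏ i, (fun x : Cn N × Cn N => x.2 i) ^ k i := by
    funext x
    simp [Finset.sum_apply, Finset.prod_apply]
  rw [he]
  exact hsum.2

/-- A polynomial given by its coefficients agrees near `0` with one of degree at most `1` only if
its coefficients of degree at least `2` vanish. -/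
theorem coeff_eq_zero_of_eventually_eq {s : Finset (Fin N → ℕ)} {c : (Fin N → ℕ) → ℂ}
    {Q : MvPolynomial (Fin N) ℂ} (hQ : Q.totalDegree ≤ 1)
    (h : ∀ᶠ β in 𝓝 (0 : Cn N), ∑ k ∈ s, c k * ∏ i, β i ^ k i = MvPolynomial.eval (fun i => β i) Q)
    {k : Fin N → ℕ} (hk : k ∈ s) (hk2 : 2 ≤ ∑ i, k i) : c k = 0 := by
  let R : MvPolynomial (Fin N) ℂ :=
    ∑ k ∈ s, MvPolynomial.monomial (Finsupp.equivFunOnFinite.symm k) (c k)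
  have hR : R = Q := by
    refine mvPolynomial_eq_of_eventually ?_
    filter_upwards [h] with β hβ
    rw [← hβ, map_sum]
    refine Finset.sum_congr rfl fun k _ => ?_
    rw [MvPolynomial.eval_monomial, Finsupp.prod_fintype _ _ (by simp)]
    simp
  have h1 : R.coeff (Finsupp.equivFunOnFinite.symm k) = c k := by
    simp only [R, MvPolynomial.coeff_sum, MvPolynomial.coeff_monomial]
    rw [Finset.sum_eq_single k]
    · simp
    · intro b _ hb
      simp [hb]
    · exact fun h => absurd hk h
  rw [← h1, hR]
  refine MvPolynomial.coeff_eq_zero_of_totalDegree_lt ?_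
  refine lt_of_le_of_lt hQ (lt_of_lt_of_le one_lt_two (hk2.trans_eq ?_))
  exact (Finsupp.sum_fintype (Finsupp.equivFunOnFinite.symm k) (fun _ n => n) (by simp)).symm

end Polynomials

/-! ### Restricting a polynomial to lines -/

section LinePolynomial

open Polynomial

variable {N : ℕ}

/-- The restriction of `P` to the line `line x.1 x.2`, as a polynomial in the last coordinate. -/
noncomputable def linePoly (P : MvPolynomial (Fin (N + 1)) ℂ) (x : Cn N × Cn N) : ℂ[X] :=
  MvPolynomial.aeval
    (Fin.snoc (α := fun _ => ℂ[X]) (fun k : Fin N => C (x.1 k) * X + C (x.2 k)) X) P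

theorem eval_linePoly (P : MvPolynomial (Fin (N + 1)) ℂ) (x : Cn N × Cn N) (t : ℂ) :
    (linePoly P x).eval t = MvPolynomial.eval (fun i => linePoint x t i) P := by
  have h : ((aeval t).comp (MvPolynomial.aeval
      (Fin.snoc (α := fun _ => ℂ[X]) (fun k : Fin N => C (x.1 k) * X + C (x.2 k)) X)) :
      MvPolynomial (Fin (N + 1)) ℂ →ₐ[ℂ] ℂ) = MvPolynomial.aeval (fun i => linePoint x t i) := by
    ext i
    refine Fin.lastCases ?_ (fun k => ?_) i <;> simp
  have := DFunLike.congr_fun h P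
  rw [AlgHom.comp_apply] at this
  simpa [linePoly, coe_aeval_eq_eval, MvPolynomial.aeval_eq_eval] using this

theorem natDegree_linePoly_le (P : MvPolynomial (Fin (N + 1)) ℂ) (x : Cn N × Cn N) :
    (linePoly P x).natDegree ≤ P.totalDegree := by
  have := MvPolynomial.aeval_natDegree_le P le_rfl
    (Fin.snoc (α := fun _ => ℂ[X]) (fun k : Fin N => C (x.1 k) * X + C (x.2 k)) X) (n := 1) ?_
  · rwa [mul_one] at this
  · intro i
    refine Fin.lastCases ?_ (fun k => ?_) i
    · simp
    · rw [Fin.snoc_castSucc]; exact natDegree_linear_le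

theorem exists_eq_C_mul_prod {ι : Type*} [Fintype ι] {p : ℂ[X]} {r : ι → ℂ}
    (hr : Function.Injective r) (hp : ∀ j, p.eval (r j) = 0)
    (hd : p.natDegree ≤ Fintype.card ι) : ∃ c, p = C c * ∏ j, (X - C (r j)) := by
  have hdvd : ∏ j, (X - C (r j)) ∣ p :=
    Finset.prod_dvd_of_coprime ((pairwise_coprime_X_sub_C hr).set_pairwise _)
      fun j _ => dvd_iff_isRoot.2 (hp j)
  obtain ⟨q, rfl⟩ := hdvd
  by_cases hq : q = 0
  · exact ⟨0, by simp [hq]⟩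
  have hm : (∏ j, (X - C (r j))).Monic := monic_prod_of_monic _ _ fun j _ => monic_X_sub_C _
  rw [hm.natDegree_mul' hq, natDegree_finsetProd_X_sub_C_eq_card, Finset.card_univ] at hd
  refine ⟨q.coeff 0, ?_⟩
  rw [mul_comm, ← eq_C_of_natDegree_eq_zero (by omega)]

/-- If `P` has degree at most `d` and `d` distinct zeros `z j x` on the line of parameter `x`, then
its restriction to this line is a multiple of `∏ j, (X - z j x)`. For `x` close to `0` the factor
stays away from `0`, since it is `1` at `x = 0` and depends continuously on `x`, as one sees from
the values at a fixed `t₀`. -/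
theorem eventually_linePoly_eq {d : ℕ} {z : Fin d → Cn N × Cn N → ℂ}
    {P : MvPolynomial (Fin (N + 1)) ℂ} (hP : P.totalDegree ≤ d)
    (hz : ∀ j, ContinuousAt (z j) 0)
    (hinj : ∀ᶠ x in 𝓝 (0 : Cn N × Cn N), Function.Injective fun j => z j x)
    (hroot : ∀ᶠ x in 𝓝 (0 : Cn N × Cn N), ∀ j,
      MvPolynomial.eval (fun i => linePoint x (z j x) i) P = 0)
    (h0 : ∀ t, MvPolynomial.eval (fun i => linePoint (0 : Cn N × Cn N) t i) P = ∏ j, (t - z j 0)) :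
    ∀ᶠ x in 𝓝 (0 : Cn N × Cn N), ∃ c : ℂ, 1 / 2 ≤ ‖c‖ ∧
      linePoly P x = C c * ∏ j, (X - C (z j x)) := by
  obtain ⟨t₀, ht₀⟩ := Infinite.exists_notMem_finset (Finset.univ.image fun j => z j 0)
  have hne : ∏ j, (t₀ - z j 0) ≠ 0 := by
    refine Finset.prod_ne_zero_iff.2 fun j _ h => ht₀ ?_
    rw [sub_eq_zero.1 h]
    exact Finset.mem_image_of_mem _ (Finset.mem_univ j)
  have hc1 : ContinuousAt (fun x : Cn N × Cn N =>
      MvPolynomial.eval (fun i => linePoint x t₀ i) P) 0 := by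
    refine (MvPolynomial.continuous_eval P).continuousAt.comp (f := fun x : Cn N × Cn N =>
      (fun i => linePoint x t₀ i)) (continuousAt_pi.2 fun i => ?_)
    have h1 : Continuous fun x : Cn N × Cn N => linePoint x t₀ := by
      have h1 := (contDiff_linePoint (N := N) (n := 0)).continuous
      have h2 : Continuous fun x : Cn N × Cn N => (x, t₀) := by fun_prop
      have h3 := h1.comp h2
      exact h3
    have h2 : Continuous fun ζ : Cn (N + 1) => ζ i := (EuclideanSpace.proj (𝕜 := ℂ) i).continuous
    exact (h2.comp h1).continuousAt
  have hc2 : ContinuousAt (fun x : Cn N × Cn N => ∏ j, (t₀ - z j x)) 0 :=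
    tendsto_finsetProd _ fun j _ => (continuousAt_const.sub (hz j))
  have hc := (hc1.div hc2 hne).norm
  have hc0 : (1 / 2 : ℝ) < ‖((fun x : Cn N × Cn N =>
      MvPolynomial.eval (fun i => linePoint x t₀ i) P) / fun x => ∏ j, (t₀ - z j x)) 0‖ := by
    rw [Pi.div_apply, h0 t₀, div_self hne]
    norm_num
  filter_upwards [hinj, hroot, hc.eventually_const_lt hc0, hc2.eventually_ne hne] with x h1 h2 h3 h4
  obtain ⟨c, hcx⟩ := exists_eq_C_mul_prod (p := linePoly P x) h1
    (fun j => by rw [eval_linePoly]; exact h2 j)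
    ((natDegree_linePoly_le P x).trans (by simpa using hP))
  refine ⟨c, ?_, hcx⟩
  have h5 := congrArg (eval t₀) hcx
  rw [eval_linePoly, eval_mul, eval_C, eval_prod] at h5
  simp only [eval_sub, eval_X, eval_C] at h5
  have h6 : MvPolynomial.eval (fun i => linePoint x t₀ i) P / ∏ j, (t₀ - z j x) = c := by
    rw [h5, mul_div_cancel_right₀ _ h4]
  have h7 : 1 / 2 < ‖MvPolynomial.eval (fun i => linePoint x t₀ i) P / ∏ j, (t₀ - z j x)‖ := h3
  rw [h6] at h7
  exact h7.le

theorem norm_linePoint_le {x : Cn N × Cn N} (hx : ‖x‖ ≤ 1) (t : ℂ) :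
    ‖linePoint x t‖ ≤ (N + 1) * (‖t‖ + 1) := by
  have hi : ∀ i, ‖linePoint x t i‖ ≤ ‖t‖ + 1 := by
    intro i
    refine Fin.lastCases ?_ (fun k => ?_) i
    · rw [linePoint_last]; linarith
    · rw [linePoint_castSucc]
      have h1 : ‖x.1 k‖ ≤ 1 := (PiLp.norm_apply_le x.1 k).trans ((norm_fst_le x).trans hx)
      have h2 : ‖x.2 k‖ ≤ 1 := (PiLp.norm_apply_le x.2 k).trans ((norm_snd_le x).trans hx)
      refine (norm_add_le _ _).trans (add_le_add ?_ h2)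
      rw [norm_mul]
      exact mul_le_of_le_one_left (norm_nonneg _) h1
  have hb : (0 : ℝ) ≤ (N + 1) * (‖t‖ + 1) := by positivity
  rw [EuclideanSpace.norm_eq]
  refine Real.sqrt_le_iff.2 ⟨hb, ?_⟩
  calc ∑ i, ‖linePoint x t i‖ ^ 2 ≤ ∑ _i : Fin (N + 1), (‖t‖ + 1) ^ 2 :=
        Finset.sum_le_sum fun i _ => pow_le_pow_left₀ (norm_nonneg _) (hi i) 2
    _ = (N + 1) * (‖t‖ + 1) ^ 2 := by simp
    _ ≤ ((N + 1) * (‖t‖ + 1)) ^ 2 := by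
        rw [mul_pow]
        refine mul_le_mul_of_nonneg_right ?_ (by positivity)
        have : (0 : ℝ) ≤ N := Nat.cast_nonneg N
        nlinarith

end LinePolynomial

/-! ### The polynomial whose zeros are the intersection points -/

section Trace

variable {N d : ℕ} {A B : Set (Cn N)} {z : Fin d → Cn N × Cn N → ℂ}

/-- If the sum of the roots is affine in the second variable, the coefficient of `X ^ m` in
`∏ j, (X - z j)` has degree at most `d - m` in that variable. -/
theorem fibreDegreeLT_rootCoeff {U : Set (Cn N × Cn N)} (hU : IsOpen U)
    (hz : ∀ j, AnalyticOnNhd ℂ (z j) U)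
    (hshock : ∀ j v, Set.EqOn (dirDeriv (v, 0) (z j)) (z j * dirDeriv (0, v) (z j)) U)
    (hS : FibreDegreeLT U 2 (∑ j, z j)) (i : ℕ) :
    ∀ m, m + i = d → FibreDegreeLT U (i + 1) (rootCoeff z Finset.univ m) := by
  have ha := analyticOnNhd_rootCoeff hz Finset.univ
  have hSa : AnalyticOnNhd ℂ (∑ j, z j) U := Finset.analyticOnNhd_sum _ fun j _ => hz j
  induction i with
  | zero =>
    intro m hm v x _
    have : rootCoeff z Finset.univ m = 1 := by
      have := rootCoeff_card z Finset.univ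
      rw [Finset.card_univ, Fintype.card_fin] at this
      rwa [show m = d by omega]
    rw [this]
    exact congrFun (dirDeriv_const _ 1) x
  | succ i ih =>
    intro m hm v
    have h := (dirDeriv_rootCoeff hz (fun j => hshock j v) Finset.univ).2 m
    have h1 := ih (m + 1) (by omega)
    refine (FibreDegreeLT.sub hU (analyticOnNhd_dirDeriv (ha (m + 1)) (v, 0))
      ((ha (m + 1)).mul (analyticOnNhd_dirDeriv hSa (0, v))) (h1.dirDeriv hU (v, 0) (ha _))
      (h1.mul_one hU (ha _) (analyticOnNhd_dirDeriv hSa _) (hS v))).congr hU fun x hx => ?_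
    have := h hx
    simp only [Pi.mul_apply, Pi.sub_apply] at this ⊢
    linear_combination -this

/-- The roots over `α = 0` are the zeros of a polynomial of degree at most `d` in `ℂ^(N+1)`. -/
theorem exists_mvPolynomial_eq_prod (hA : IsOpen A) (hA0 : (0 : Cn N) ∈ A) (hB : IsOpen B)
    (hBc : Convex ℝ B) (hB0 : (0 : Cn N) ∈ B) (hz : ∀ j, AnalyticOnNhd ℂ (z j) (A ×ˢ B))
    (hshock : ∀ j v, Set.EqOn (dirDeriv (v, 0) (z j)) (z j * dirDeriv (0, v) (z j)) (A ×ˢ B))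
    (hS : FibreDegreeLT (A ×ˢ B) 2 (∑ j, z j)) :
    ∃ P : MvPolynomial (Fin (N + 1)) ℂ, P.totalDegree ≤ d ∧ ∀ β ∈ B, ∀ ζ : Cn (N + 1),
      (∀ k, ζ k.castSucc = β k) →
      MvPolynomial.eval (fun i => ζ i) P = ∏ j, (ζ (Fin.last N) - z j (0, β)) := by
  have hdeg := fibreDegreeLT_rootCoeff (hA.prod hB) hz hshock hS
  have hQ : ∀ m, ∃ Q : MvPolynomial (Fin N) ℂ, m ≤ d → Q.totalDegree ≤ d - m ∧
      ∀ β ∈ B, rootCoeff z Finset.univ m (0, β) = MvPolynomial.eval (fun i => β i) Q := by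
    intro m
    by_cases hm : m ≤ d
    · obtain ⟨Q, h1, h2⟩ := FibreDegreeLT.exists_mvPolynomial hB hBc hB0 hA0 (d - m) _
        (analyticOnNhd_rootCoeff hz Finset.univ m) (hdeg (d - m) m (by omega))
      exact ⟨Q, fun _ => ⟨h1, h2⟩⟩
    · exact ⟨0, fun h => absurd h hm⟩
  choose Q hQ using hQ
  refine ⟨∑ m ∈ Finset.range (d + 1), MvPolynomial.rename Fin.castSucc (Q m) *
    MvPolynomial.X (Fin.last N) ^ m, ?_, fun β hβ ζ hζ => ?_⟩
  · refine MvPolynomial.totalDegree_finsetSum_le fun m hm => ?_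
    have hm' : m ≤ d := by have := Finset.mem_range.1 hm; omega
    refine (MvPolynomial.totalDegree_mul _ _).trans ?_
    have h1 := (MvPolynomial.totalDegree_rename_le Fin.castSucc (Q m)).trans (hQ m hm').1
    have h2 : (MvPolynomial.X (Fin.last N) ^ m : MvPolynomial (Fin (N + 1)) ℂ).totalDegree = m := by
      simp
    omega
  · have h := sum_rootCoeff_mul_pow z Finset.univ (0, β) (ζ (Fin.last N))
    rw [Finset.card_univ, Fintype.card_fin] at h
    rw [← h, map_sum]
    refine Finset.sum_congr rfl fun m hm => ?_
    have hm' : m ≤ d := by have := Finset.mem_range.1 hm; omega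
    rw [map_mul, map_pow, MvPolynomial.eval_X, MvPolynomial.eval_rename, (hQ m hm').2 β hβ]
    congr 3
    ext k
    exact hζ k

end Trace

/-! ### The algebraic hypersurface -/

variable {N d : ℕ}

/-- A trace that is affine in `β` has no monomials of degree at least `2` in `β`. -/
theorem eq_zero_of_fibreDegreeLT_two {A B : Set (Cn N)} (hB : IsOpen B)
    (hBc : Convex ℝ B) (hB0 : (0 : Cn N) ∈ B) {f : Cn N × Cn N → ℂ}
    (hf : AnalyticOnNhd ℂ f (A ×ˢ B)) (hf2 : FibreDegreeLT (A ×ˢ B) 2 f)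
    {s : Finset (Fin N → ℕ)} {h : (Fin N → ℕ) → Cn N → ℂ}
    (hsum : ∀ x ∈ A ×ˢ B, f x = ∑ k ∈ s, h k x.1 * ∏ i, x.2 i ^ k i)
    {k : Fin N → ℕ} (hk : k ∈ s) (hk2 : 2 ≤ ∑ i, k i) {α : Cn N} (hα : α ∈ A) : h k α = 0 := by
  obtain ⟨Q, hQ, hQf⟩ := FibreDegreeLT.exists_mvPolynomial hB hBc hB0 hα 1 f hf hf2
  refine coeff_eq_zero_of_eventually_eq (c := fun k => h k α) hQ ?_ hk hk2
  filter_upwards [hB.mem_nhds hB0] with β hβ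
  rw [← hQf β hβ]
  exact (hsum (α, β) ⟨hα, hβ⟩).symm

/-- Far away on a line of parameter close to `0`, a polynomial whose zeros on that line are bounded
grows at least like the power `d` of the norm. -/
theorem le_norm_mul_prod {x : Cn N × Cn N} (hx : ‖x‖ ≤ 1) {t c : ℂ} {r : Fin d → ℂ} {M : ℝ}
    (hr : ∀ j, ‖r j‖ ≤ M) (hc : 1 / 2 ≤ ‖c‖)
    (ht : 2 * (N + 1) * (M + 1) ≤ ‖linePoint x t‖) :
    1 / 2 * (1 / (2 * (N + 1))) ^ d * ‖linePoint x t‖ ^ d ≤ ‖c * ∏ j, (t - r j)‖ := by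
  have hN : (0 : ℝ) < 2 * (N + 1) := by positivity
  have h1 := norm_linePoint_le hx t
  have h2 : 1 / (2 * (N + 1)) * ‖linePoint x t‖ ≤ ‖t‖ - M := by
    rw [one_div, inv_mul_le_iff₀ hN]
    nlinarith
  rw [mul_assoc, ← mul_pow, norm_mul, norm_prod]
  refine mul_le_mul hc ?_ (by positivity) (norm_nonneg _)
  calc (1 / (2 * (N + 1)) * ‖linePoint x t‖) ^ d
      = ∏ _j : Fin d, (1 / (2 * (N + 1)) * ‖linePoint x t‖) := by simp
    _ ≤ ∏ j, ‖t - r j‖ := Finset.prod_le_prod (fun _ _ => by positivity) fun j _ =>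
        h2.trans ((sub_le_sub_left (hr j) _).trans (norm_sub_norm_le t (r j)))

end AffineWood

open AffineWood

theorem proposition5p3 {N d : ℕ} (γ : Fin d → Set (AffineWood.Cn (N + 1)))
    (hγ : ∀ j, AffineWood.IsSmoothHypersurfacePiece (γ j))
    (hdisj : ∀ i j, i ≠ j → Disjoint (γ i) (γ j))
    (p : Fin d → AffineWood.Cn N → AffineWood.Cn N → AffineWood.Cn (N + 1))
    (hp : ∀ᶠ ab : AffineWood.Cn N × AffineWood.Cn N in 𝓝 (0, 0), ∀ j,
      AffineWood.line ab.1 ab.2 ∩ γ j = {p j ab.1 ab.2} ∧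
      AffineWood.IsTransversalAt (γ j) (p j ab.1 ab.2) (AffineWood.direction ab.1))
    (D : ℕ) (h : (Fin N → ℕ) → AffineWood.Cn N → ℂ)
    (h_analytic : ∀ k ∈ AffineWood.multiIndices N (D + 1), AnalyticAt ℂ (h k) 0)
    (hsum : ∀ᶠ ab : AffineWood.Cn N × AffineWood.Cn N in 𝓝 (0, 0),
      ∑ j, p j ab.1 ab.2 (Fin.last N) =
        ∑ k ∈ AffineWood.multiIndices N (D + 1), h k ab.1 * ∏ i, ab.2 i ^ k i)
    (htop : ∃ k : Fin N → ℕ, ∑ i, k i = D + 1 ∧ ¬ (∀ᶠ α in 𝓝 (0 : AffineWood.Cn N), h k α = 0)) :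
    ∃ P : MvPolynomial (Fin (N + 1)) ℂ, P.totalDegree = d + D ∧
      ∃ ε κ K : ℝ, 0 < ε ∧ 0 < κ ∧ 0 < K ∧
        (∀ ζ ∈ AffineWood.tube N ε, K ≤ ‖ζ‖ →
          κ * ‖ζ‖ ^ d ≤ ‖MvPolynomial.eval (fun i => ζ i) P‖) ∧
        (∀ α β : AffineWood.Cn N, max ‖α‖ ‖β‖ < ε →
          AffineWood.line α β ∩ AffineWood.zeroSet P = Set.range fun j => p j α β) := by
  let z : Fin d → Cn N × Cn N → ℂ := fun j x => p j x.1 x.2 (Fin.last N)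
  have hz0 : ∀ j, AnalyticAt ℂ (z j) 0 := fun j =>
    analyticAt_last_of_transversal (S := γ j) (q := fun x => p j x.1 x.2)
      (hp.mono fun x hx => (hx j).1) (hp.self_of_nhds j).2
  have hza : ∀ᶠ x in 𝓝 (0 : Cn N × Cn N), ∀ j, AnalyticAt ℂ (z j) x :=
    eventually_all.2 fun j => (hz0 j).eventually_analyticAt
  have hha : ∀ᶠ x in 𝓝 (0 : Cn N × Cn N), ∀ k ∈ multiIndices N (D + 1),
      AnalyticAt ℂ (h k) x.1 :=
    (Finset.eventually_all _).2 fun k hk =>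
      (continuous_fst.tendsto (0 : Cn N × Cn N)).eventually (h_analytic k hk).eventually_analyticAt
  obtain ⟨ρ, hρ, hball⟩ := Metric.eventually_nhds_iff_ball.1
    (hp.eventually_nhds.and (hza.and (hha.and hsum)))
  set A : Set (Cn N) := Metric.ball 0 ρ with hAdef
  have hA : IsOpen A := Metric.isOpen_ball
  have hAc : Convex ℝ A := convex_ball 0 ρ
  have hA0 : (0 : Cn N) ∈ A := Metric.mem_ball_self hρ
  have hAA : Metric.ball ((0 : Cn N), (0 : Cn N)) ρ = A ×ˢ A := (ball_prod_same _ _ _).symm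
  rw [hAA] at hball
  have hU : IsOpen (A ×ˢ A) := hA.prod hA
  have hUc : IsPreconnected (A ×ˢ A) := (hAc.prod hAc).isPreconnected
  have hz : ∀ j, AnalyticOnNhd ℂ (z j) (A ×ˢ A) := fun j x hx => (hball x hx).2.1 j
  have hshock : ∀ j v, Set.EqOn (dirDeriv (v, 0) (z j)) (z j * dirDeriv (0, v) (z j)) (A ×ˢ A) :=
    fun j v x hx => dirDeriv_last_eq (S := γ j) (q := fun x => p j x.1 x.2)
      ((hball x hx).1.mono fun y hy => (hy j).1) (hz j x hx) v
  have hSa : AnalyticOnNhd ℂ (∑ j, z j) (A ×ˢ A) := Finset.analyticOnNhd_sum _ fun j _ => hz j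
  have hSsum : ∀ x ∈ A ×ˢ A, (∑ j, z j) x =
      ∑ k ∈ multiIndices N (D + 1), h k x.1 * ∏ i, x.2 i ^ k i := fun x hx => by
    rw [Finset.sum_apply]
    exact (hball x hx).2.2.2
  have hS2 : FibreDegreeLT (A ×ˢ A) 2 (∑ j, z j) := by
    refine fibreDegreeLT_two_of_forall_dirDegreeLT hSa fun v => ?_
    refine dirDegreeLT_two_sum hU hUc ⟨(0, 0), hA0, hA0⟩ hz (fun j => hshock j v) _ ?_
    obtain ⟨n, hn⟩ := exists_dirDegreeLT_sum hU (multiIndices N (D + 1)) (h := h)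
      (fun k hk α hα => (hball (α, 0) ⟨hα, hA0⟩).2.2.1 k hk) v
    exact ⟨n, hn.congr hU hSsum⟩
  -- Since the sum is affine in `β`, a monomial of degree `D + 1 ≥ 2` cannot occur.
  have hD : D = 0 := by
    by_contra hD
    obtain ⟨k, hk, hk0⟩ := htop
    refine hk0 ?_
    filter_upwards [hA.mem_nhds hA0] with α hα
    exact eq_zero_of_fibreDegreeLT_two hA hAc hA0 hSa hS2 hSsum
      (mem_multiIndices.2 hk.le) (by omega) hα
  obtain ⟨P, hPd, hP⟩ := exists_mvPolynomial_eq_prod hA hA0 hA hAc hA0 hz hshock hS2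
  have hinj : ∀ᶠ x in 𝓝 (0 : Cn N × Cn N), Function.Injective fun j => z j x := by
    filter_upwards [hp] with x hx i j hij
    by_contra hne
    have hi := eq_linePoint_of_inter_eq (q := fun x => p i x.1 x.2) (hx i).1
    have hj := eq_linePoint_of_inter_eq (q := fun x => p j x.1 x.2) (hx j).1
    have he : p i x.1 x.2 = p j x.1 x.2 := hi.trans ((congrArg (linePoint x) hij).trans hj.symm)
    exact Set.disjoint_left.1 (hdisj i j hne) (hx i).2.1 (he ▸ (hx j).2.1)
  -- The point `p j x.1 x.2` also lies on the line of parameters `(0, x.2 + z j x • x.1)`, parallel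
  -- to the last axis, and `P` is known on such lines.
  have hroot : ∀ᶠ x in 𝓝 (0 : Cn N × Cn N), ∀ j,
      MvPolynomial.eval (fun i => linePoint x (z j x) i) P = 0 := by
    refine eventually_all.2 fun j => ?_
    have hc : ContinuousAt (fun x : Cn N × Cn N => x.2 + z j x • x.1) 0 :=
      continuousAt_snd.add ((hz0 j).continuousAt.smul continuousAt_fst)
    have hm : ∀ᶠ x in 𝓝 (0 : Cn N × Cn N), x.2 + z j x • x.1 ∈ A :=
      hc.eventually_mem (by simpa using hA.mem_nhds hA0)
    filter_upwards [hm, hp] with x hxA hx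
    rw [hP _ hxA _ fun k => by simp [mul_comm, add_comm]]
    refine Finset.prod_eq_zero (Finset.mem_univ j) ?_
    have hy := ((hball (0, x.2 + z j x • x.1) ⟨hA0, hxA⟩).1.self_of_nhds j).1
    rw [linePoint_last, sub_eq_zero]
    refine (last_eq_of_inter_eq (q := fun x => p j x.1 x.2) (hx j).1 hy fun k => ?_).symm
    simp [z]
    ring
  have hP0 : ∀ t, MvPolynomial.eval (fun i => linePoint (0 : Cn N × Cn N) t i) P =
      ∏ j, (t - z j 0) := fun t => by
    rw [hP 0 hA0 _ fun k => by simp, linePoint_last]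
    rfl
  have hfac := eventually_linePoly_eq hPd (fun j => (hz0 j).continuousAt) hinj hroot hP0
  have hdeg : P.totalDegree = d := by
    obtain ⟨c, hc, hcP⟩ := hfac.self_of_nhds
    refine le_antisymm hPd ?_
    have h1 := natDegree_linePoly_le P 0
    have hc0 : c ≠ 0 := fun h => by rw [h] at hc; norm_num at hc
    rwa [hcP, Polynomial.natDegree_C_mul hc0, Polynomial.natDegree_finsetProd_X_sub_C_eq_card,
      Finset.card_univ, Fintype.card_fin] at h1
  let M : ℝ := 1 + ∑ j, ‖z j 0‖
  have hM : ∀ᶠ x in 𝓝 (0 : Cn N × Cn N), ∀ j, ‖z j x‖ ≤ M := by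
    refine eventually_all.2 fun j => ?_
    have h1 : ‖z j 0‖ < M := by
      have := Finset.single_le_sum (f := fun j => ‖z j 0‖) (fun i _ => norm_nonneg _)
        (Finset.mem_univ j)
      simp only [M]
      linarith
    exact ((hz0 j).continuousAt.norm.eventually_lt_const h1).mono fun x hx => hx.le
  have hM0 : 0 ≤ M := by positivity
  obtain ⟨ε₀, hε₀, hε⟩ := Metric.eventually_nhds_iff_ball.1 (hfac.and (hM.and hp))
  have hmem : ∀ α β : Cn N, max ‖α‖ ‖β‖ < min ε₀ 1 →
      (α, β) ∈ Metric.ball (0 : Cn N × Cn N) ε₀ ∧ ‖((α, β) : Cn N × Cn N)‖ ≤ 1 := by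
    intro α β hαβ
    rw [← Prod.norm_mk] at hαβ
    exact ⟨by simpa using hαβ.trans_le (min_le_left _ _), (hαβ.trans_le (min_le_right _ _)).le⟩
  have heval : ∀ (x : Cn N × Cn N) (t c : ℂ),
      linePoly P x = Polynomial.C c * ∏ j, (Polynomial.X - Polynomial.C (z j x)) →
      MvPolynomial.eval (fun i => linePoint x t i) P = c * ∏ j, (t - z j x) := by
    intro x t c hc
    rw [← eval_linePoly, hc, Polynomial.eval_mul, Polynomial.eval_prod]
    simp
  refine ⟨P, by rw [hdeg, hD, add_zero], min ε₀ 1, 1 / 2 * (1 / (2 * (N + 1))) ^ d,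
    2 * (N + 1) * (M + 1), lt_min hε₀ one_pos, by positivity, by positivity, ?_, ?_⟩
  · intro ζ hζ hK
    simp only [tube, Set.mem_iUnion] at hζ
    obtain ⟨α, β, hαβ, hζ⟩ := hζ
    obtain ⟨hb, hb1⟩ := hmem α β hαβ
    obtain ⟨⟨c, hc, hcP⟩, hMx, -⟩ := hε _ hb
    have hζ' := mem_line_iff (x := (α, β)).1 hζ
    rw [hζ'] at hK ⊢
    rw [heval _ _ c hcP]
    exact le_norm_mul_prod hb1 hMx hc hK
  · intro α β hαβ
    obtain ⟨hb, -⟩ := hmem α β hαβ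
    obtain ⟨⟨c, hc, hcP⟩, -, hx⟩ := hε _ hb
    have hc0 : c ≠ 0 := fun h => by rw [h] at hc; norm_num at hc
    have hpj : ∀ j, p j α β = linePoint (α, β) (z j (α, β)) := fun j =>
      eq_linePoint_of_inter_eq (q := fun x => p j x.1 x.2) (hx j).1
    ext ζ
    constructor
    · rintro ⟨hζ, hζP⟩
      have hζ' := mem_line_iff (x := (α, β)).1 hζ
      rw [zeroSet, Set.mem_ofPred_eq, hζ', heval _ _ c hcP] at hζP
      obtain ⟨j, -, hj⟩ := Finset.prod_eq_zero_iff.1 ((mul_eq_zero.1 hζP).resolve_left hc0)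
      refine ⟨j, ?_⟩
      rw [hζ', sub_eq_zero.1 hj]
      exact hpj j
    · rintro ⟨j, rfl⟩
      simp only [hpj j]
      refine ⟨linePoint_mem_line (α, β) _, ?_⟩
      rw [zeroSet, Set.mem_ofPred_eq, heval _ _ c hcP]
      exact mul_eq_zero_of_right _ (Finset.prod_eq_zero (Finset.mem_univ j) (sub_self _))
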